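/- **Setting.** Let $n,M\ge 0$, $\tau>0$, $b\in\mathbb R$, $\rho_{\rm eq},\rho_{\rm ineq}\ge 0$, $p_{\rm ref}\in\mathbb R^n$ and, for each agent $i=0,\dots,M$, $c_i\in\mathbb R^n$, $d_i\in\mathbb R$, $l_{\max,i}\in\mathbb R^n$. For a price $p\in\mathbb R^n$ let $l^\star(p)=(l_0^\star(p),\dots,l_M^\star(p))$ be the unique minimizer over $(\mathbb R^n)^{M+1}$ of $$\sum_{i=0}^M\Big(p^\top l_i+0.01\,l_i^\top l_i+\rho_{\rm eq}(c_i^\top l_i-d_i)^2\Big)+\rho_{\rm ineq}\sum_{i=0}^M\Big(\|\max(0,-l_i)\|_2^2+\|\max(0,l_i-l_{\max,i})\|_2^2\Big),$$ let $l_{\rm agg}(p)=\sum_i l^\star_i(p)$, and let $\Phi_{\rm DSO}(p)=F(p,l_{\rm agg}(p))$, where $$F(p,l)=\tau\log\sum_{j}e^{l_j/\tau}+b\,(p^\top l-p_{\rm ref}^\top l)^2 .$$ Let $\mathcal P\subset\mathbb R^n$ be compact and convex, with metric projection $\Pi_{\mathcal P}$ and normal cone $N_{\mathcal P}(x)=\{v:\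 v^\top(q-x)\le 0\ \ \forall q\in\mathcal P\}$. **Algorithm.** On a probability space with filtration $(\mathcal F_t)_{t\ge0}$, the prices satisfy $p_0\in\mathcal P$ ($p_0$ is $\mathcal F_0$-measurable) and $$p_{t+1}=\Pi_{\mathcal P}(p_t-\alpha_t\hat g_t),\qquad \hat g_t=\frac{\partial F}{\partial p}(p_t,y_t)+\hat h_t^\top\frac{\partial F}{\partial l}(p_t,y_t)-e_t .$$ Here $y_t=l_{\rm agg}(p_t)+v_t$ is the measured aggregate load with arbitrary (possibly zero) measurement error $v_t$, $e_t$ is an arbitrary (possibly zero) excitation signal, and $\hat h_t\in\mathbb R^{n\times n}$ is the online sensitivity estimate: $\hat s_t=\mathrm{vec}(\hat h_t)$ is given by the Kalman filter $$\hat s_{k+1}=\hat s_k+K_k(\Delta l_k-P_k\hat s_k),\quad \Sigma_{k+1}=(I-K_kP_k)\Sigma_k+\Sigma_{p,k},\quad K_k=\Sigma_kP_k^\top(\Sigma_{m,k}+P_k\Sigma_kP_k^\top)^{-1},$$ with $P_k=(p_{k+1}-p_k)^\top\otimes I$, $\Delta l_k=y_{k+1}-y_k$, an arbitrary initial matrix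 $\hat h_0$, positive semidefinite $\Sigma_0,\Sigma_{p,k}$ and positive definite $\Sigma_{m,k}$. **Assumptions.** 1. $\alpha_t>0$, $\sum_t\alpha_t=\infty$, $\sum_t\alpha_t^2<\infty$. 2. $\Phi_{\rm DSO}$ is continuously differentiable on $\mathcal P$, and its gradient $\nabla\Phi_{\rm DSO}$ is Lipschitz continuous on $\mathcal P$. (Derivatives are taken relative to $\mathcal P$; if $\mathcal P$ has empty interior, $\nabla\Phi_{\rm DSO}$ is any fixed Lipschitz field of such gradients.) 3. The gradient error $\xi_t=\hat g_t-\nabla\Phi_{\rm DSO}(p_t)$ is $\mathcal F_{t+1}$-measurable with $\sup_t\mathbb E\|\xi_t\|^2<\infty$, and it is a martingale-difference sequence, $\mathbb E[\xi_t\mid\mathcal F_t]=0$; more generally, it may be only asymptotically unbiased, in the sense that $\|\mathbb E[\xi_t\mid\mathcal F_t]\|\le\beta_t$ almost surely for constants $\beta_t$ with $\sum_t\alpha_t\beta_t<\infty$. **Conclusion.** The set $$\mathcal S=\{p^\star\in\mathcal P:\ 0\in\nabla\Phi_{\rm DSO}(p^\star)+N_{\mathcal P}(p^\star)\}$$ of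 constrained stationary points of $\min_{p\in\mathcal P}\Phi_{\rm DSO}(p)$ (the stationarity condition of the smooth MPEC) is nonempty, and almost surely $\mathrm{dist}(p_t,\mathcal S)\to0$ as $t\to\infty$ and every limit point $p^\star$ of $(p_t)$ lies in $\mathcal S$, i.e. satisfies $0\in\nabla\Phi_{\rm DSO}(p^\star)+N_{\mathcal P}(p^\star)$. -/

import Mathlib

open MeasureTheory Filter Topology

namespace SmoothOFO

/-- Price vectors and load profiles over `n` time slots, with the Euclidean inner product. -/
abbrev Vec (n : ℕ) := EuclideanSpace ℝ (Fin n)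

/-! ### The smoothed pricing problem -/

/-- The log-sum-exp smoothing `τ log ∑ⱼ exp (zⱼ / τ)` of the maximum. -/
noncomputable def lse {n : ℕ} (τ : ℝ) (z : Vec n) : ℝ :=
  τ * Real.log (∑ j, Real.exp (z j / τ))

/-- Data of the smoothed pricing problem with `n` time slots and agents `0, …, M`:
the smoothing parameter `τ`, the weight `b` and the reference price of the upper level, the
penalty weights, and for every agent `i` the equality constraint `c i ⬝ l i = d i` and the
upper bound `lMax i`, both of which enter the lower level as penalties. -/
structure Model (n M : ℕ) where
  τ : ℝ
  τ_pos : 0 < τ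
  b : ℝ
  pRef : Vec n
  ρEq : ℝ
  ρEq_nonneg : 0 ≤ ρEq
  ρIneq : ℝ
  ρIneq_nonneg : 0 ≤ ρIneq
  c : Fin (M + 1) → Vec n
  d : Fin (M + 1) → ℝ
  lMax : Fin (M + 1) → Vec n

namespace Model

variable {n M : ℕ}

/-- The upper-level objective `F(p, l) = LSE_τ(l) + b (pᵀ l - p_refᵀ l)²`, as a function of the
price and of the aggregate load. -/
noncomputable def upperObj (m : Model n M) (p l : Vec n) : ℝ :=
  lse m.τ l + m.b * (inner ℝ p l - inner ℝ m.pRef l) ^ 2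

/-- The lower-level objective: charging cost plus quadratic regularization plus quadratic
penalties for the equality constraints and for the bounds `0 ≤ l i ≤ lMax i`. -/
noncomputable def agentObj (m : Model n M) (p : Vec n) (l : Fin (M + 1) → Vec n) : ℝ :=
  ∑ i, (inner ℝ p (l i) + 0.01 * inner ℝ (l i) (l i)
      + m.ρEq * (inner ℝ (m.c i) (l i) - m.d i) ^ 2)
    + m.ρIneq * ∑ i, (∑ j, (max 0 (-(l i j))) ^ 2 + ∑ j, (max 0 (l i j - m.lMax i j)) ^ 2)

/-- The contribution of one agent to the lower-level objective. -/
noncomputable def agentTerm (m : Model n M) (p : Vec n) (i : Fin (M + 1)) (x : Vec n) : ℝ :=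
  inner ℝ p x + 0.01 * inner ℝ x x + m.ρEq * (inner ℝ (m.c i) x - m.d i) ^ 2
    + m.ρIneq * (∑ j, (max 0 (-(x j))) ^ 2 + ∑ j, (max 0 (x j - m.lMax i j)) ^ 2)

theorem agentObj_eq_sum (m : Model n M) (p : Vec n) (l : Fin (M + 1) → Vec n) :
    m.agentObj p l = ∑ i, m.agentTerm p i (l i) := by
  simp only [agentObj, agentTerm, Finset.sum_add_distrib, mul_add, Finset.mul_sum _ _ m.ρIneq]

theorem continuous_agentTerm (m : Model n M) (p : Vec n) (i : Fin (M + 1)) :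
    Continuous (m.agentTerm p i) := by
  unfold agentTerm
  fun_prop

theorem agentTerm_coercive (m : Model n M) (p : Vec n) (i : Fin (M + 1)) :
    Tendsto (m.agentTerm p i) (cocompact _) atTop := by
  have h1 : Tendsto (fun x : Vec n => ‖x‖ * (0.01 * ‖x‖ - ‖p‖)) (cocompact _) atTop := by
    have hn : Tendsto (fun x : Vec n => ‖x‖) (cocompact _) atTop := tendsto_norm_cocompact_atTop
    refine hn.atTop_mul_atTop₀ ?_
    exact tendsto_atTop_add_const_right _ (-‖p‖) (hn.const_mul_atTop (by norm_num))
  refine tendsto_atTop_mono (fun x => ?_) h1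
  have h2 : -(‖p‖ * ‖x‖) ≤ inner ℝ p x := (abs_le.1 (abs_real_inner_le_norm p x)).1
  have h3 : (inner ℝ x x : ℝ) = ‖x‖ ^ 2 := real_inner_self_eq_norm_sq x
  have h4 : 0 ≤ m.ρEq * (inner ℝ (m.c i) x - m.d i) ^ 2 := mul_nonneg m.ρEq_nonneg (sq_nonneg _)
  have h5 : 0 ≤ m.ρIneq * (∑ j, (max 0 (-(x j))) ^ 2 + ∑ j, (max 0 (x j - m.lMax i j)) ^ 2) :=
    mul_nonneg m.ρIneq_nonneg (add_nonneg (Finset.sum_nonneg fun _ _ => sq_nonneg _)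
      (Finset.sum_nonneg fun _ _ => sq_nonneg _))
  unfold agentTerm
  rw [h3]
  nlinarith

theorem sq_midpoint_le (a b : ℝ) : ((a + b) / 2) ^ 2 ≤ (a ^ 2 + b ^ 2) / 2 := by
  nlinarith [sq_nonneg (a - b)]

theorem sq_max_midpoint_le (a b : ℝ) :
    (max 0 ((a + b) / 2)) ^ 2 ≤ ((max 0 a) ^ 2 + (max 0 b) ^ 2) / 2 := by
  refine le_trans ?_ (sq_midpoint_le _ _)
  have h : max 0 ((a + b) / 2) ≤ (max 0 a + max 0 b) / 2 := by
    refine max_le (by positivity) ?_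
    linarith [le_max_right 0 a, le_max_right 0 b]
  have h0 : 0 ≤ max 0 ((a + b) / 2) := le_max_left _ _
  gcongr

theorem agentTerm_midpoint (m : Model n M) (p : Vec n) (i : Fin (M + 1)) (x y : Vec n) :
    m.agentTerm p i ((1 / 2 : ℝ) • (x + y)) + 0.0025 * ‖x - y‖ ^ 2
      ≤ (m.agentTerm p i x + m.agentTerm p i y) / 2 := by
  have e1 : (inner ℝ x x : ℝ) = ‖x‖ ^ 2 := real_inner_self_eq_norm_sq x
  have e2 : (inner ℝ y y : ℝ) = ‖y‖ ^ 2 := real_inner_self_eq_norm_sq y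
  have e3 : ‖x - y‖ ^ 2 = ‖x‖ ^ 2 - 2 * inner ℝ x y + ‖y‖ ^ 2 := norm_sub_sq_real x y
  have e4 : (inner ℝ y x : ℝ) = inner ℝ x y := real_inner_comm _ _
  have k1 := mul_le_mul_of_nonneg_left
    (sq_midpoint_le (inner ℝ (m.c i) x - m.d i) (inner ℝ (m.c i) y - m.d i)) m.ρEq_nonneg
  have k2 : ∑ j, (max 0 (-(((1 / 2 : ℝ) • (x + y)) j))) ^ 2
      ≤ (∑ j, (max 0 (-(x j))) ^ 2 + ∑ j, (max 0 (-(y j))) ^ 2) / 2 := by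
    rw [← Finset.sum_add_distrib, Finset.sum_div]
    refine Finset.sum_le_sum fun j _ => ?_
    refine le_trans (le_of_eq ?_) (sq_max_midpoint_le _ _)
    simp only [PiLp.smul_apply, PiLp.add_apply, smul_eq_mul]
    ring_nf
  have k3 : ∑ j, (max 0 (((1 / 2 : ℝ) • (x + y)) j - m.lMax i j)) ^ 2
      ≤ (∑ j, (max 0 (x j - m.lMax i j)) ^ 2 + ∑ j, (max 0 (y j - m.lMax i j)) ^ 2) / 2 := by
    rw [← Finset.sum_add_distrib, Finset.sum_div]
    refine Finset.sum_le_sum fun j _ => ?_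
    refine le_trans (le_of_eq ?_) (sq_max_midpoint_le _ _)
    simp only [PiLp.smul_apply, PiLp.add_apply, smul_eq_mul]
    ring_nf
  have k4 := mul_le_mul_of_nonneg_left (add_le_add k2 k3) m.ρIneq_nonneg
  have k5 : (inner ℝ (m.c i) x + inner ℝ (m.c i) y) * (1 / 2) - m.d i
      = (inner ℝ (m.c i) x - m.d i + (inner ℝ (m.c i) y - m.d i)) / 2 := by ring
  unfold agentTerm
  simp only [inner_smul_right, inner_smul_left, inner_add_left, inner_add_right,
    RCLike.conj_to_real, e1, e2, e3, e4]
  rw [mul_comm (1 / 2 : ℝ) (inner ℝ (m.c i) x + inner ℝ (m.c i) y), k5]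
  linarith

/-- By strong convexity the lower-level problem has exactly one solution, at every price. -/
theorem existsUnique_agentOpt (m : Model n M) (p : Vec n) :
    ∃! l : Fin (M + 1) → Vec n, ∀ l', m.agentObj p l ≤ m.agentObj p l' := by
  have hex : ∀ i, ∃ x, ∀ y, m.agentTerm p i x ≤ m.agentTerm p i y := fun i =>
    (m.continuous_agentTerm p i).exists_forall_le (m.agentTerm_coercive p i)
  choose l hl using hex
  refine ⟨l, fun l' => ?_, fun l₂ h₂ => ?_⟩
  · rw [agentObj_eq_sum, agentObj_eq_sum]
    exact Finset.sum_le_sum fun i _ => hl i (l' i)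
  · have h3 : ∑ i, (m.agentTerm p i (l₂ i) - m.agentTerm p i (l i)) ≤ 0 := by
      have := h₂ l
      rw [agentObj_eq_sum, agentObj_eq_sum] at this
      rw [Finset.sum_sub_distrib]
      linarith
    have h4 : ∀ i ∈ Finset.univ, 0 ≤ m.agentTerm p i (l₂ i) - m.agentTerm p i (l i) :=
      fun i _ => sub_nonneg.2 (hl i _)
    have h5 := (Finset.sum_eq_zero_iff_of_nonneg h4).1 (le_antisymm h3 (Finset.sum_nonneg h4))
    funext i
    have h6 := h5 i (Finset.mem_univ i)
    have h7 := m.agentTerm_midpoint p i (l₂ i) (l i)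
    have h8 := hl i ((1 / 2 : ℝ) • (l₂ i + l i))
    have h9 : ‖l₂ i - l i‖ ^ 2 ≤ 0 := by linarith
    exact sub_eq_zero.1 (norm_eq_zero.1 (pow_eq_zero_iff (two_ne_zero)|>.1
      (le_antisymm h9 (sq_nonneg _))))

/-- The lower-level response `l⋆(p)`: the unique minimizer of `agentObj p`. -/
noncomputable def agentOpt (m : Model n M) (p : Vec n) : Fin (M + 1) → Vec n :=
  (m.existsUnique_agentOpt p).choose

/-- The aggregate load `∑ᵢ l⋆ᵢ(p)` induced by the price `p`. -/
noncomputable def aggLoad (m : Model n M) (p : Vec n) : Vec n :=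
  ∑ i, m.agentOpt p i

/-- The reduced objective `Φ_DSO(p) = F(p, l⋆(p))`. -/
noncomputable def reducedObj (m : Model n M) (p : Vec n) : ℝ :=
  m.upperObj p (m.aggLoad p)

end Model

/-! ### Online sensitivity learning: the Kalman filter -/

/-- Parameters of the online sensitivity learning: the initial sensitivity matrix, its covariance,
and the covariances of the process and measurement noises. The index `(j, i)` of a vectorized
matrix stands for the entry in row `i` and column `j` (column-wise vectorization). -/
structure KalmanParams (n : ℕ) where
  H₀ : Matrix (Fin n) (Fin n) ℝ
  cov₀ : Matrix (Fin n × Fin n) (Fin n × Fin n) ℝ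
  cov₀_posSemidef : cov₀.PosSemidef
  covProc : ℕ → Matrix (Fin n × Fin n) (Fin n × Fin n) ℝ
  covProc_posSemidef : ∀ k, (covProc k).PosSemidef
  covMeas : ℕ → Matrix (Fin n) (Fin n) ℝ
  covMeas_posDef : ∀ k, (covMeas k).PosDef

/-- The regressor `Δpᵀ ⊗ I`. -/
def regressor {n : ℕ} (Δp : Vec n) : Matrix (Fin n) (Fin n × Fin n) ℝ :=
  Matrix.of fun i ja => Δp ja.1 * (1 : Matrix (Fin n) (Fin n) ℝ) i ja.2

namespace KalmanParams

variable {n : ℕ}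

/-- The Kalman gain `Σ Pᵀ (Σ_m + P Σ Pᵀ)⁻¹`. -/
noncomputable def gain (κ : KalmanParams n) (k : ℕ)
    (S : Matrix (Fin n × Fin n) (Fin n × Fin n) ℝ) (R : Matrix (Fin n) (Fin n × Fin n) ℝ) :
    Matrix (Fin n × Fin n) (Fin n) ℝ :=
  S * R.transpose * (κ.covMeas k + R * S * R.transpose)⁻¹

open Matrix in
/-- The state `(ŝₖ, Σₖ)` of the filter along a sequence `p` of prices and a sequence `y` of
measured aggregate loads; step `k` uses `Δpₖ = pₖ₊₁ - pₖ` and `Δlₖ = yₖ₊₁ - yₖ`. -/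
noncomputable def state (κ : KalmanParams n) (p y : ℕ → Vec n) :
    ℕ → (Fin n × Fin n → ℝ) × Matrix (Fin n × Fin n) (Fin n × Fin n) ℝ
  | 0 => (κ.H₀.vec, κ.cov₀)
  | k + 1 =>
    let s := (κ.state p y k).1
    let S := (κ.state p y k).2
    let R := regressor (p (k + 1) - p k)
    let K := κ.gain k S R
    (s + K *ᵥ ((y (k + 1) - y k).ofLp - R *ᵥ s), (1 - K * R) * S + κ.covProc k)

/-- The sensitivity estimate `ĥₖ`: the vector `ŝₖ` reshaped into a matrix. -/
noncomputable def sensitivity (κ : KalmanParams n) (p y : ℕ → Vec n) (k : ℕ) :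
    Matrix (Fin n) (Fin n) ℝ :=
  Matrix.of fun i j => (κ.state p y k).1 (j, i)

end KalmanParams

/-! ### The projected stochastic recursion -/

open Matrix in
/-- The gradient estimate
`ĝₜ = ∂F/∂p (pₜ, yₜ) + ĥₜᵀ ∂F/∂l (pₜ, yₜ) - eₜ` along a sequence `p` of prices, a sequence `y` of
measured aggregate loads and a sequence `e` of excitation signals added to the descent
direction. -/
noncomputable def gradEstimate {n M : ℕ} (m : Model n M) (κ : KalmanParams n)
    (p y e : ℕ → Vec n) (t : ℕ) : Vec n :=
  gradient (fun q => m.upperObj q (y t)) (p t)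
    + WithLp.toLp 2 ((κ.sensitivity p y t)ᵀ *ᵥ (gradient (fun l => m.upperObj (p t) l) (y t)).ofLp)
    - e t

/-- `y` is the metric projection `Π_P(x)` of `x` onto `P`. -/
def IsMetricProj {n : ℕ} (P : Set (Vec n)) (x y : Vec n) : Prop :=
  y ∈ P ∧ ∀ q ∈ P, ‖x - y‖ ≤ ‖x - q‖

/-- A run of smoothed online feedback optimization on a sample space `Ω` with step sizes `α`: the
prices `p` start in `P` and follow `pₜ₊₁ = Π_P(pₜ - αₜ ĝₜ)`. The measured load is
`l_agg(pₜ) + vₜ` with an arbitrary (possibly zero) measurement error `v`, and `e` is an arbitrary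
(possibly zero) excitation signal. -/
structure IsRun {n M : ℕ} (m : Model n M) (κ : KalmanParams n) (P : Set (Vec n)) (α : ℕ → ℝ)
    {Ω : Type*} (p y v e : ℕ → Ω → Vec n) : Prop where
  init : ∀ ω, p 0 ω ∈ P
  measured : ∀ t ω, y t ω = m.aggLoad (p t ω) + v t ω
  step : ∀ t ω, IsMetricProj P
    (p t ω - α t • gradEstimate m κ (fun s => p s ω) (fun s => y s ω) (fun s => e s ω) t)
    (p (t + 1) ω)

/-- The error `ξₜ = ĝₜ - G(pₜ)` of the gradient estimate, where `G` is the gradient of the reduced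
objective. -/
noncomputable def gradNoise {n M : ℕ} (m : Model n M) (κ : KalmanParams n) (G : Vec n → Vec n)
    {Ω : Type*} (p y e : ℕ → Ω → Vec n) (t : ℕ) (ω : Ω) : Vec n :=
  gradEstimate m κ (fun s => p s ω) (fun s => y s ω) (fun s => e s ω) t - G (p t ω)

/-! ### Stationarity -/

/-- The normal cone to `P` at `x`. -/
def normalCone {n : ℕ} (P : Set (Vec n)) (x : Vec n) : Set (Vec n) :=
  {v | ∀ q ∈ P, inner ℝ v (q - x) ≤ 0}

/-- The points `x ∈ P` with `0 ∈ G(x) + N_P(x)`. -/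
def stationarySet {n : ℕ} (P : Set (Vec n)) (G : Vec n → Vec n) : Set (Vec n) :=
  {x | x ∈ P ∧ ∃ v ∈ normalCone P x, G x + v = 0}

end SmoothOFO

/-!
The theorem is a convergence theorem for the projected stochastic gradient method with a Lipschitz
gradient field `G` and no convexity of the objective `f`. Nothing about the model, the Kalman filter
or the measurements enters except through the error `ξₜ` of the gradient estimate: the recursion is
`pₜ₊₁ = Π_P(pₜ - αₜ (G(pₜ) + ξₜ))`.

Since the projection does not commute with the expectation, `f(pₜ)` itself need not decrease in mean.
The Lyapunov function is instead the Moreau envelope of `f` over `P`,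
`x ↦ min_{q ∈ P} f(q) + (L + 1) ‖q - x‖²`. Its minimizer `w(x)` is unique and Lipschitz in `x`
because `f` is weakly convex (`IsProx.norm_sub_le`), and its fixed points are stationary
(`mem_stationarySet_of_isProx`). Comparing `pₜ₊₁` with the point `w(pₜ)` of `P` gives a descent
inequality in which the noise enters linearly, so that `∑ αₜ ‖w(pₜ) - pₜ‖²` converges
(`summable_mul_prox_residual_sq`).

To pass from this to `‖w(pₜ) - pₜ‖ → 0`, the iterates must not move fast. Comparing `pₜ` with the
fixed point `pₛ` of `P` bounds `‖pₜ - pₛ‖²` by the step sizes between `s` and `t` plus increments of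
convergent series (`exists_forall_norm_sub_le_of_sum_le`), and a residual that is square-summable
with weights `αₜ` and slowly varying tends to zero (`tendsto_zero_of_summable_mul_sq`). Everything
else is compactness of `P` and continuity of `w`.

Probability is needed only to see that the noise series `∑ αₜ ξₜ`, `∑ αₜ ⟪ξₜ, pₜ⟫`,
`∑ αₜ ⟪ξₜ, w(pₜ)⟫` and `∑ αₜ² ‖ξₜ‖²` converge almost surely. The first three are `L²`-bounded
martingales up to the summable bias (`ae_exists_tendsto_sum_inner`); after that the argument is
pathwise.
-/

namespace SmoothOFO

/-! ### Almost sure convergence of the noise series -/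

section Probability

variable {Ω : Type*} [mΩ : MeasurableSpace Ω] {μ : Measure Ω}

theorem ae_summable_of_summable_integral {F : ℕ → Ω → ℝ} (hF0 : ∀ t ω, 0 ≤ F t ω)
    (hFint : ∀ t, Integrable (F t) μ) {B : ℕ → ℝ} (hB : Summable B)
    (hFB : ∀ t, ∫ ω, F t ω ∂μ ≤ B t) : ∀ᵐ ω ∂μ, Summable fun t => F t ω := by
  have hmeas : ∀ t, AEMeasurable (fun ω => ENNReal.ofReal (F t ω)) μ :=
    fun t => (hFint t).aestronglyMeasurable.aemeasurable.ennreal_ofReal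
  have hsum : Summable fun t => ∫ ω, F t ω ∂μ :=
    hB.of_nonneg_of_le (fun t => integral_nonneg (hF0 t)) hFB
  have hfin : ∫⁻ ω, ∑' t, ENNReal.ofReal (F t ω) ∂μ ≠ ⊤ := by
    rw [lintegral_tsum hmeas]
    simp_rw [← ofReal_integral_eq_lintegral_ofReal (hFint _) (ae_of_all _ (hF0 _))]
    exact hsum.tsum_ofReal_ne_top
  filter_upwards [ae_lt_top' (AEMeasurable.tsum hmeas) hfin] with ω hω
  have := ENNReal.summable_toReal hω.ne
  simpa [ENNReal.toReal_ofReal (hF0 _ _)] using this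

/-- The martingale convergence theorem in `L²`: orthogonality of the increments bounds the second
moments of the partial sums. -/
theorem ae_exists_tendsto_sum_of_condExp_eq_zero [IsProbabilityMeasure μ] {ℱ : Filtration ℕ mΩ}
    {Y : ℕ → Ω → ℝ} (hmeas : ∀ t, StronglyMeasurable[ℱ (t + 1)] (Y t))
    (hL2 : ∀ t, MemLp (Y t) 2 μ) (hcond : ∀ t, μ[Y t | ℱ t] =ᵐ[μ] 0)
    {B : ℕ → ℝ} (hB : Summable B) (hYB : ∀ t, ∫ ω, Y t ω ^ 2 ∂μ ≤ B t) :
    ∀ᵐ ω ∂μ, ∃ c, Tendsto (fun T => ∑ t ∈ Finset.range T, Y t ω) atTop (𝓝 c) := by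
  set S : ℕ → Ω → ℝ := fun T ω => ∑ t ∈ Finset.range T, Y t ω with hS
  have hSL2 : ∀ T, MemLp (S T) 2 μ := fun T => memLp_finsetSum _ fun t _ => hL2 t
  have hSint : ∀ T, Integrable (S T) μ := fun T => (hSL2 T).integrable (by norm_num)
  have hSmeas : StronglyAdapted ℱ S := fun T => by
    refine Finset.stronglyMeasurable_fun_sum _ fun t ht => ?_
    exact (hmeas t).mono (ℱ.mono (Finset.mem_range.1 ht))
  have hmart : Martingale S ℱ μ := by
    refine martingale_of_condExp_sub_eq_zero_nat hSmeas hSint fun t => ?_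
    have : S (t + 1) - S t = Y t := by
      ext ω; simp [hS, Finset.sum_range_succ]
    rw [this]; exact hcond t
  have hB0 : ∀ t, 0 ≤ B t := fun t => (integral_nonneg fun ω => sq_nonneg _).trans (hYB t)
  have hsq : ∀ T, ∫ ω, S T ω ^ 2 ∂μ ≤ ∑ t ∈ Finset.range T, B t := by
    intro T
    induction T with
    | zero => simp [hS]
    | succ T ih =>
      have hprod : Integrable (fun ω => S T ω * Y T ω) μ := (hSL2 T).integrable_mul (hL2 T)
      have hcross : ∫ ω, S T ω * Y T ω ∂μ = 0 := by
        rw [← integral_condExp (ℱ.le T)]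
        have h1 := condExp_mul_of_stronglyMeasurable_left (hSmeas T) hprod
          ((hL2 T).integrable (by norm_num))
        have h2 : μ[fun ω => S T ω * Y T ω | ℱ T] =ᵐ[μ] 0 := by
          refine h1.trans ?_
          filter_upwards [hcond T] with ω hω
          simp [hω]
        rw [integral_congr_ae h2]; simp
      have hexp : ∀ ω, S (T + 1) ω ^ 2 = S T ω ^ 2 + 2 * (S T ω * Y T ω) + Y T ω ^ 2 := by
        intro ω; simp only [hS, Finset.sum_range_succ]; ring
      simp_rw [hexp]
      have i1 := (hSL2 T).integrable_sq
      have i2 := (hL2 T).integrable_sq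
      have i12 : Integrable (fun ω => S T ω ^ 2 + 2 * (S T ω * Y T ω)) μ :=
        i1.add (hprod.const_mul 2)
      rw [integral_add i12 i2, integral_add i1 (hprod.const_mul 2),
        integral_const_mul, hcross, Finset.sum_range_succ]
      linarith [hYB T]
  have hL1 : ∀ T, eLpNorm (S T) 1 μ ≤ (Real.toNNReal (1 + ∑' t, B t) : NNReal) := by
    intro T
    rw [eLpNorm_one_eq_lintegral_enorm, ← ofReal_integral_norm_eq_lintegral_enorm (hSint T)]
    refine ENNReal.ofReal_le_ofReal ?_
    have i1 := (hSL2 T).integrable_sq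
    calc ∫ ω, ‖S T ω‖ ∂μ ≤ ∫ ω, (1 + S T ω ^ 2) ∂μ := by
          refine integral_mono (hSint T).norm ((integrable_const _).add i1) fun ω => ?_
          simp only [Real.norm_eq_abs]
          nlinarith [sq_abs (S T ω), sq_nonneg (|S T ω| - 1)]
      _ = 1 + ∫ ω, S T ω ^ 2 ∂μ := by
          rw [integral_add (integrable_const _) i1]; simp
      _ ≤ _ := by linarith [hsq T, hB.sum_le_tsum (Finset.range T) fun t _ => hB0 t]
  exact hmart.submartingale.exists_ae_tendsto_of_bdd hL1

/-- Subtracting the conditional means leaves martingale increments, and these have no larger second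
moments. -/
theorem ae_exists_tendsto_sum_of_abs_condExp_le [IsProbabilityMeasure μ] {ℱ : Filtration ℕ mΩ}
    {X : ℕ → Ω → ℝ} (hmeas : ∀ t, StronglyMeasurable[ℱ (t + 1)] (X t))
    (hL2 : ∀ t, MemLp (X t) 2 μ) {b : ℕ → ℝ} (hb : Summable b)
    (hcond : ∀ t, ∀ᵐ ω ∂μ, |(μ[X t | ℱ t]) ω| ≤ b t)
    {B : ℕ → ℝ} (hB : Summable B) (hXB : ∀ t, ∫ ω, X t ω ^ 2 ∂μ ≤ B t) :
    ∀ᵐ ω ∂μ, ∃ c, Tendsto (fun T => ∑ t ∈ Finset.range T, X t ω) atTop (𝓝 c) := by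
  have hint : ∀ t, Integrable (X t) μ := fun t => (hL2 t).integrable (by norm_num)
  have hCL2 : ∀ t, MemLp (μ[X t | ℱ t]) 2 μ := fun t => (hL2 t).condExp (by norm_num)
  have key := ae_exists_tendsto_sum_of_condExp_eq_zero (μ := μ) (ℱ := ℱ)
    (Y := fun t => X t - μ[X t | ℱ t])
    (fun t => (hmeas t).sub (stronglyMeasurable_condExp.mono (ℱ.mono t.le_succ)))
    (fun t => (hL2 t).sub (hCL2 t)) (fun t => ?_) hB (fun t => ?_)
  · filter_upwards [key, ae_all_iff.2 hcond] with ω ⟨c, hc⟩ hω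
    have hs : Summable fun t => (μ[X t | ℱ t]) ω := Summable.of_norm_bounded hb hω
    refine ⟨c + ∑' t, (μ[X t | ℱ t]) ω, (hc.add hs.hasSum.tendsto_sum_nat).congr fun T => ?_⟩
    simp [Finset.sum_sub_distrib]
  · refine (condExp_sub (hint t) integrable_condExp _).trans ?_
    rw [condExp_of_stronglyMeasurable (ℱ.le t) stronglyMeasurable_condExp integrable_condExp]
    simp
  · have h1 := ProbabilityTheory.condVar_ae_le_condExp_sq (ℱ.le t) (hL2 t)
    have h2 := integral_mono_ae integrable_condExp integrable_condExp h1
    change ∫ ω, (μ[(X t - μ[X t | ℱ t]) ^ 2 | ℱ t]) ω ∂μ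
      ≤ ∫ ω, (μ[X t ^ 2 | ℱ t]) ω ∂μ at h2
    rw [integral_condExp (ℱ.le t), integral_condExp (ℱ.le t)] at h2
    exact h2.trans (hXB t)

variable {E : Type*} [NormedAddCommGroup E] [InnerProductSpace ℝ E] [CompleteSpace E]

/-- The accumulated effect `∑ αₜ ⟪ξₜ, hₜ⟫` of the noise along a bounded adapted direction
converges. -/
theorem ae_exists_tendsto_sum_inner [IsProbabilityMeasure μ] {ℱ : Filtration ℕ mΩ}
    {α : ℕ → ℝ} (hα : ∀ t, 0 < α t) (hαsq : Summable fun t => α t ^ 2)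
    {ξ : ℕ → Ω → E} (hξmeas : ∀ t, StronglyMeasurable[ℱ (t + 1)] (ξ t))
    (hξL2 : ∀ t, MemLp (ξ t) 2 μ) {σ : ℝ} (hξvar : ∀ t, ∫ ω, ‖ξ t ω‖ ^ 2 ∂μ ≤ σ ^ 2)
    {β : ℕ → ℝ} (hβ : Summable fun t => α t * β t)
    (hξbias : ∀ t, ∀ᵐ ω ∂μ, ‖(μ[ξ t | ℱ t]) ω‖ ≤ β t)
    {h : ℕ → Ω → E} (hh : ∀ t, StronglyMeasurable[ℱ t] (h t)) {R : ℝ}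
    (hR : ∀ t ω, ‖h t ω‖ ≤ R) :
    ∀ᵐ ω ∂μ, ∃ c, Tendsto (fun T => ∑ t ∈ Finset.range T, α t * inner ℝ (ξ t ω) (h t ω))
      atTop (𝓝 c) := by
  have hξint : ∀ t, Integrable (ξ t) μ := fun t => (hξL2 t).integrable (by norm_num)
  have hm : ∀ t, StronglyMeasurable[ℱ (t + 1)] fun ω => inner ℝ (ξ t ω) (h t ω) := fun t =>
    (hξmeas t).inner ((hh t).mono (ℱ.mono t.le_succ))
  have hle : ∀ t ω, |inner ℝ (ξ t ω) (h t ω)| ≤ R * ‖ξ t ω‖ := fun t ω => by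
    rw [mul_comm]
    exact (abs_real_inner_le_norm _ _).trans (mul_le_mul_of_nonneg_left (hR t ω) (norm_nonneg _))
  have hL2 : ∀ t, MemLp (fun ω => inner ℝ (ξ t ω) (h t ω)) 2 μ := fun t =>
    (hξL2 t).of_le_mul ((hm t).mono (ℱ.le _)).aestronglyMeasurable (ae_of_all _ (hle t))
  refine ae_exists_tendsto_sum_of_abs_condExp_le (ℱ := ℱ) (b := fun t => R * (α t * β t))
    (B := fun t => α t ^ 2 * (R ^ 2 * σ ^ 2)) (fun t => (hm t).const_mul (α t))
    (fun t => (hL2 t).const_mul (α t)) (hβ.mul_left R) (fun t => ?_) (hαsq.mul_right _)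
    (fun t => ?_)
  · have h1 := condExp_smul (m := ℱ t) (μ := μ) (α t) fun ω => inner ℝ (ξ t ω) (h t ω)
    have h2 := condExp_bilin_of_stronglyMeasurable_right (μ := μ) (innerSL ℝ) (hh t)
      (f := ξ t) ((hL2 t).integrable (by norm_num)) (hξint t)
    filter_upwards [h1, h2, hξbias t] with ω h1 h2 h3
    have h4 : (μ[fun ω => α t * inner ℝ (ξ t ω) (h t ω) | ℱ t]) ω
        = α t * inner ℝ ((μ[ξ t | ℱ t]) ω) (h t ω) := by
      refine h1.trans ?_
      rw [Pi.smul_apply, smul_eq_mul]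
      exact congrArg _ h2
    rw [h4, abs_mul, abs_of_pos (hα t)]
    calc α t * |inner ℝ ((μ[ξ t | ℱ t]) ω) (h t ω)|
        ≤ α t * (‖(μ[ξ t | ℱ t]) ω‖ * ‖h t ω‖) :=
          mul_le_mul_of_nonneg_left (abs_real_inner_le_norm _ _) (hα t).le
      _ ≤ α t * (β t * R) := mul_le_mul_of_nonneg_left
          (mul_le_mul h3 (hR t ω) (norm_nonneg _) ((norm_nonneg _).trans h3)) (hα t).le
      _ = R * (α t * β t) := by ring
  · calc ∫ ω, (α t * inner ℝ (ξ t ω) (h t ω)) ^ 2 ∂μ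
        ≤ ∫ ω, α t ^ 2 * (R ^ 2 * ‖ξ t ω‖ ^ 2) ∂μ := by
          refine integral_mono ((hL2 t).const_mul (α t)).integrable_sq
            (((hξL2 t).norm.integrable_sq.const_mul _).const_mul _) fun ω => ?_
          simp only [mul_pow]
          refine mul_le_mul_of_nonneg_left ?_ (sq_nonneg _)
          rw [← mul_pow, ← sq_abs (inner ℝ (ξ t ω) (h t ω))]
          exact pow_le_pow_left₀ (abs_nonneg _) (hle t ω) 2
      _ = α t ^ 2 * (R ^ 2 * ∫ ω, ‖ξ t ω‖ ^ 2 ∂μ) := by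
          rw [integral_const_mul, integral_const_mul]
      _ ≤ _ := by
          gcongr
          exact hξvar t

theorem ae_exists_tendsto_sum_smul [FiniteDimensional ℝ E] [IsProbabilityMeasure μ]
    {ℱ : Filtration ℕ mΩ}
    {α : ℕ → ℝ} (hα : ∀ t, 0 < α t) (hαsq : Summable fun t => α t ^ 2)
    {ξ : ℕ → Ω → E} (hξmeas : ∀ t, StronglyMeasurable[ℱ (t + 1)] (ξ t))
    (hξL2 : ∀ t, MemLp (ξ t) 2 μ) {σ : ℝ} (hξvar : ∀ t, ∫ ω, ‖ξ t ω‖ ^ 2 ∂μ ≤ σ ^ 2)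
    {β : ℕ → ℝ} (hβ : Summable fun t => α t * β t)
    (hξbias : ∀ t, ∀ᵐ ω ∂μ, ‖(μ[ξ t | ℱ t]) ω‖ ≤ β t) :
    ∀ᵐ ω ∂μ, ∃ c, Tendsto (fun T => ∑ t ∈ Finset.range T, α t • ξ t ω) atTop (𝓝 c) := by
  set B := stdOrthonormalBasis ℝ E
  have h1 := ae_all_iff.2 fun i => ae_exists_tendsto_sum_inner hα hαsq hξmeas hξL2 hξvar hβ hξbias
    (h := fun _ _ => B i) (fun _ => stronglyMeasurable_const) (R := 1) (fun _ _ => by simp)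
  filter_upwards [h1] with ω hω
  choose c hc using hω
  refine ⟨∑ i, c i • B i,
    (tendsto_finsetSum Finset.univ fun i _ => (hc i).smul_const (B i)).congr fun T => ?_⟩
  rw [← B.sum_repr' (∑ t ∈ Finset.range T, α t • ξ t ω)]
  refine Finset.sum_congr rfl fun i _ => ?_
  simp only [inner_sum, inner_smul_right, real_inner_comm]

end Probability

/-! ### Projections, proximal points and the pathwise analysis of the recursion -/

section Deterministic

/-- A nonnegative sequence that is square-summable with respect to non-summable weights has to
become small again and again; it tends to zero if it can only grow little over windows of small
total weight. -/
theorem tendsto_zero_of_summable_mul_sq {α D : ℕ → ℝ} (hα : ∀ t, 0 < α t)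
    (hα0 : Tendsto α atTop (𝓝 0)) (hαsum : ¬ Summable α) (hD : ∀ t, 0 ≤ D t)
    (hαD : Summable fun t => α t * D t ^ 2)
    (hslow : ∀ ε > 0, ∃ N, ∃ η > 0, ∀ s ≥ N, ∀ t ≥ s,
      ∑ k ∈ Finset.Ico s t, α k ≤ η → D t ≤ D s + ε) :
    Tendsto D atTop (𝓝 0) := by
  rw [Metric.tendsto_atTop]
  intro ε₀ hε₀
  set ε := ε₀ / 3 with hε
  have hε0 : 0 < ε := by positivity
  obtain ⟨N, η, hη, hN⟩ := hslow ε hε0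
  obtain ⟨N₁, hN₁⟩ := eventually_atTop.1 (hα0.eventually_le_const (half_pos hη))
  obtain ⟨N₂, hN₂⟩ := Metric.cauchySeq_iff'.1 hαD.hasSum.tendsto_sum_nat.cauchySeq
    (η / 2 * ε ^ 2 / 2) (by positivity)
  -- over any late window the part of the weight carried by the times with `ε ≤ D` is small
  have htail : ∀ s ≥ N₂, ∀ t ≥ s, ∑ k ∈ Finset.Ico s t, α k * D k ^ 2 ≤ η / 2 * ε ^ 2 := by
    intro s hs t ht
    rw [Finset.sum_Ico_eq_sub _ ht]
    have a1 := hN₂ s hs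
    have a2 := hN₂ t (hs.trans ht)
    rw [Real.dist_eq] at a1 a2
    linarith [(abs_lt.1 a1).1, (abs_lt.1 a2).2]
  obtain ⟨t₀, ht₀, hDt₀⟩ : ∃ t₀ ≥ max N (max N₁ N₂), D t₀ < ε := by
    by_contra! hcon
    refine hαsum ((summable_nat_add_iff (max N (max N₁ N₂))).1 ?_)
    refine Summable.of_nonneg_of_le (fun t => (hα _).le) (fun t => ?_)
      (((summable_nat_add_iff (max N (max N₁ N₂))).2 hαD).mul_left (1 / ε ^ 2))
    have h1 : ε ^ 2 ≤ D (t + max N (max N₁ N₂)) ^ 2 :=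
      pow_le_pow_left₀ hε0.le (hcon _ (Nat.le_add_left _ _)) 2
    rw [one_div, inv_mul_eq_div, le_div_iff₀ (by positivity)]
    exact mul_le_mul_of_nonneg_left h1 (hα _).le
  -- `s` is the last time before `t` with `D s < ε`, except that `s = t` for `t = t₀`
  have hlast : ∀ t ≥ t₀, ∃ s ≥ t₀, s ≤ t ∧ D s < ε ∧ ∀ k, s < k → k < t → ε ≤ D k := by
    intro t ht
    induction t, ht using Nat.le_induction with
    | base => exact ⟨t₀, le_rfl, le_rfl, hDt₀, fun k h1 h2 => by omega⟩
    | succ t ht ih =>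
      by_cases hDt : D t < ε
      · exact ⟨t, ht, t.le_succ, hDt, fun k h1 h2 => by omega⟩
      · obtain ⟨s, h1, h2, h3, h4⟩ := ih
        refine ⟨s, h1, h2.trans t.le_succ, h3, fun k hk hk' => ?_⟩
        rcases (Nat.lt_succ_iff_lt_or_eq.1 hk') with h | rfl
        · exact h4 k hk h
        · exact not_lt.1 hDt
  refine ⟨t₀, fun t ht => ?_⟩
  obtain ⟨s, hs0, hst, hDs, hbig⟩ := hlast t ht
  have hsN : N ≤ s ∧ N₁ ≤ s ∧ N₂ ≤ s := by
    refine ⟨?_, ?_, ?_⟩ <;> have := ht₀.trans hs0 <;> simp at this <;> omega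
  have hweight : ∑ k ∈ Finset.Ico s t, α k ≤ η := by
    rcases hst.eq_or_lt with rfl | hlt
    · simpa using hη.le
    rw [Finset.sum_eq_sum_Ico_succ_bot hlt]
    have h1 : ε ^ 2 * ∑ k ∈ Finset.Ico (s + 1) t, α k ≤ η / 2 * ε ^ 2 := by
      rw [Finset.mul_sum]
      refine (Finset.sum_le_sum fun k hk => ?_).trans (htail (s + 1) (by omega) t hlt)
      rw [Finset.mem_Ico] at hk
      rw [mul_comm]
      exact mul_le_mul_of_nonneg_left
        (pow_le_pow_left₀ hε0.le (hbig k (by omega) hk.2) 2) (hα k).le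
    have h2 : ∑ k ∈ Finset.Ico (s + 1) t, α k ≤ η / 2 := by
      refine le_of_mul_le_mul_left ?_ (by positivity : 0 < ε ^ 2)
      linarith
    linarith [hN₁ s hsN.2.1]
  have := hN s hsN.1 t hst hweight
  rw [Real.dist_eq, sub_zero, abs_of_nonneg (hD t)]
  linarith

variable {E : Type*} [NormedAddCommGroup E]

/-- `w` is a proximal point of `x` for `f` on `P`: it minimizes `f + c ‖· - x‖²` over `P`. The
minimal value is the Moreau envelope of `f` at `x`; in the usual notation with parameter `lam`, the
constant `c` is `1 / (2 * lam)`. -/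
def IsProx (f : E → ℝ) (P : Set E) (c : ℝ) (x w : E) : Prop :=
  w ∈ P ∧ ∀ q ∈ P, f w + c * ‖w - x‖ ^ 2 ≤ f q + c * ‖q - x‖ ^ 2

theorem exists_isProx {f : E → ℝ} {P : Set E} (hP : IsCompact P) (hne : P.Nonempty)
    (hf : ContinuousOn f P) (c : ℝ) (x : E) : ∃ w, IsProx f P c x w := by
  have hc : ContinuousOn (fun q => f q + c * ‖q - x‖ ^ 2) P :=
    hf.add (by fun_prop)
  exact hP.exists_isMinOn hne hc

/-- The Cauchy criterion for a convergent, not necessarily summable, series. -/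
theorem exists_forall_norm_sum_Ico_lt {u : ℕ → E} {l : E}
    (hu : Tendsto (fun T => ∑ t ∈ Finset.range T, u t) atTop (𝓝 l)) {ε : ℝ} (hε : 0 < ε) :
    ∃ N, ∀ s ≥ N, ∀ t ≥ s, ‖∑ k ∈ Finset.Ico s t, u k‖ < ε := by
  obtain ⟨N, hN⟩ := Metric.cauchySeq_iff.1 hu.cauchySeq ε hε
  refine ⟨N, fun s hs t ht => ?_⟩
  have h1 := hN t (hs.trans ht) s hs
  rwa [dist_eq_norm, ← Finset.sum_Ico_eq_sub _ ht] at h1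

variable [InnerProductSpace ℝ E]

theorem inner_sub_le_zero_of_forall_norm_sub_le {P : Set E} (hP : Convex ℝ P) {x y : E}
    (hy : y ∈ P) (hmin : ∀ q ∈ P, ‖x - y‖ ≤ ‖x - q‖) {q : E} (hq : q ∈ P) :
    inner ℝ (x - y) (q - y) ≤ 0 := by
  refine (norm_eq_iInf_iff_real_inner_le_zero hP hy).1 (le_antisymm ?_ ?_) q hq
  · have : Nonempty P := ⟨⟨y, hy⟩⟩
    exact le_ciInf fun w => hmin w w.2
  · exact ciInf_le ⟨0, by rintro _ ⟨w, rfl⟩; exact norm_nonneg _⟩ (⟨y, hy⟩ : P)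

theorem norm_sub_sq_le_of_forall_norm_sub_le {P : Set E} (hP : Convex ℝ P) {x y : E}
    (hy : y ∈ P) (hmin : ∀ q ∈ P, ‖x - y‖ ≤ ‖x - q‖) {q : E} (hq : q ∈ P) :
    ‖y - q‖ ^ 2 ≤ ‖x - q‖ ^ 2 := by
  have h1 := inner_sub_le_zero_of_forall_norm_sub_le hP hy hmin hq
  have h2 : x - q = (x - y) - (q - y) := by abel
  rw [h2, norm_sub_sq_real (x - y), norm_sub_rev y q]
  nlinarith [sq_nonneg ‖x - y‖]

/-- The variational inequalities of two projections make the projection nonexpansive. -/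
theorem norm_sub_le_of_inner_sub_le_zero {x y x' y' : E} (h : inner ℝ (x - y) (y' - y) ≤ 0)
    (h' : inner ℝ (x' - y') (y - y') ≤ 0) : ‖y - y'‖ ≤ ‖x - x'‖ := by
  have h1 : ‖y - y'‖ ^ 2 ≤ inner ℝ (x - x') (y - y') := by
    have e : inner ℝ (x - x') (y - y')
        = ‖y - y'‖ ^ 2 - inner ℝ (x - y) (y' - y) - inner ℝ (x' - y') (y - y') := by
      rw [← real_inner_self_eq_norm_sq]
      simp only [inner_sub_left, inner_sub_right]
      ring
    linarith
  have h2 := real_inner_le_norm (x - x') (y - y')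
  by_contra! hcon
  nlinarith [norm_nonneg (x - x'), norm_nonneg (y - y')]

/-- The iterates move little over late windows of small total step size: the recursion is compared
with the fixed point `p s` of `P`, which turns the noise into the convergent series `∑ αₜ ξₜ` and
`∑ αₜ ⟪ξₜ, pₜ⟫` and makes the reflection at the boundary of `P` harmless. -/
theorem exists_forall_norm_sub_le_of_sum_le
    {P : Set E} {C R : ℝ} {α : ℕ → ℝ} (hα : ∀ t, 0 < α t) {p g ξ : ℕ → E} (hp : ∀ t, p t ∈ P)
    (hgC : ∀ t, ‖g t‖ ≤ C) (hpR : ∀ t, ‖p t‖ ≤ R)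
    (hstep : ∀ t, ∀ q ∈ P, ‖p (t + 1) - q‖ ^ 2 ≤ ‖p t - α t • (g t + ξ t) - q‖ ^ 2)
    (hsq : Summable fun t => α t ^ 2 * ‖g t + ξ t‖ ^ 2)
    {a : E} (hξ : Tendsto (fun T => ∑ t ∈ Finset.range T, α t • ξ t) atTop (𝓝 a))
    {c : ℝ} (hξp : Tendsto (fun T => ∑ t ∈ Finset.range T, α t * inner ℝ (ξ t) (p t))
      atTop (𝓝 c)) {δ : ℝ} (hδ : 0 < δ) :
    ∃ N, ∃ η > 0, ∀ s ≥ N, ∀ t ≥ s, ∑ k ∈ Finset.Ico s t, α k ≤ η → ‖p t - p s‖ ≤ δ := by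
  have hC0 : 0 ≤ C := (norm_nonneg _).trans (hgC 0)
  have hR0 : 0 ≤ R := (norm_nonneg _).trans (hpR 0)
  -- telescoping the projection inequality with comparison point `p s`
  have hwin : ∀ s, ∀ t ≥ s, ‖p t - p s‖ ^ 2 ≤ 4 * C * R * ∑ k ∈ Finset.Ico s t, α k
      + 2 * inner ℝ (∑ k ∈ Finset.Ico s t, α k • ξ k) (p s)
      - 2 * ∑ k ∈ Finset.Ico s t, α k * inner ℝ (ξ k) (p k)
      + ∑ k ∈ Finset.Ico s t, α k ^ 2 * ‖g k + ξ k‖ ^ 2 := by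
    intro s t ht
    induction t, ht using Nat.le_induction with
    | base => simp
    | succ t ht ih =>
      simp only [Finset.sum_Ico_succ_top ht, inner_add_left, real_inner_smul_left]
      have h1 := hstep t (p s) (hp s)
      have e1 : p t - α t • (g t + ξ t) - p s = (p t - p s) - α t • (g t + ξ t) := by abel
      rw [e1, norm_sub_sq_real (p t - p s), real_inner_smul_right, norm_smul, mul_pow, Real.norm_eq_abs,
        sq_abs, inner_add_right, real_inner_comm (ξ t), inner_sub_right (ξ t)] at h1
      have h2 : -(2 * C * R) ≤ inner ℝ (p t - p s) (g t) := by
        have h3 := (abs_le.1 (abs_real_inner_le_norm (p t - p s) (g t))).1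
        have h4 : ‖p t - p s‖ * ‖g t‖ ≤ (R + R) * C :=
          mul_le_mul ((norm_sub_le _ _).trans (add_le_add (hpR t) (hpR s))) (hgC t)
            (norm_nonneg _) (by positivity)
        linarith
      have h5 := mul_le_mul_of_nonneg_left h2 (hα t).le
      linarith
  obtain ⟨N₁, hN₁⟩ := exists_forall_norm_sum_Ico_lt hξ
    (by positivity : 0 < δ ^ 2 / (8 * (R + 1)))
  obtain ⟨N₂, hN₂⟩ := exists_forall_norm_sum_Ico_lt hξp
    (by positivity : 0 < δ ^ 2 / 8)
  obtain ⟨N₃, hN₃⟩ := exists_forall_norm_sum_Ico_lt hsq.hasSum.tendsto_sum_nat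
    (by positivity : 0 < δ ^ 2 / 4)
  refine ⟨max N₁ (max N₂ N₃), δ ^ 2 / (16 * (C * R + 1)), by positivity, fun s hs t ht hη => ?_⟩
  simp only [ge_iff_le, max_le_iff] at hs
  have b1 := hN₁ s hs.1 t ht
  have b2 := hN₂ s hs.2.1 t ht
  have b3 := hN₃ s hs.2.2 t ht
  rw [Real.norm_eq_abs] at b2 b3
  have c0 : 4 * C * R * ∑ k ∈ Finset.Ico s t, α k ≤ δ ^ 2 / 4 := by
    rw [le_div_iff₀ (by positivity)] at hη
    have : 0 ≤ ∑ k ∈ Finset.Ico s t, α k := Finset.sum_nonneg fun k _ => (hα k).le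
    linarith
  have c1 : inner ℝ (∑ k ∈ Finset.Ico s t, α k • ξ k) (p s) ≤ δ ^ 2 / 8 := by
    refine (real_inner_le_norm _ _).trans ?_
    rw [lt_div_iff₀ (by positivity)] at b1
    have := mul_le_mul_of_nonneg_left (hpR s) (norm_nonneg (∑ k ∈ Finset.Ico s t, α k • ξ k))
    linarith [norm_nonneg (∑ k ∈ Finset.Ico s t, α k • ξ k)]
  refine abs_le_of_sq_le_sq' ?_ hδ.le |>.2
  linarith [hwin s t ht, (abs_lt.1 b2).1, (abs_lt.1 b3).2]

variable [CompleteSpace E] {f : E → ℝ} {P : Set E} {G : E → E} {L : NNReal}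

/-- A Lipschitz gradient makes `f` weakly convex on `P`. -/
theorem inner_gradient_le (hP : Convex ℝ P) (hG : ∀ x ∈ P, HasGradientWithinAt f (G x) P x)
    (hLip : LipschitzOnWith L G P) {p q : E} (hp : p ∈ P) (hq : q ∈ P) :
    inner ℝ (G p) (q - p) ≤ f q - f p + L * ‖q - p‖ ^ 2 := by
  obtain ⟨z, hz, hfz⟩ := domain_mvt (fun x hx => (hG x hx).hasFDerivWithinAt) hP hp hq
  have hzP : z ∈ P := hP.segment_subset hp hq hz
  have hzp : ‖p - z‖ ≤ ‖q - p‖ := by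
    obtain ⟨a, b, ha, hb, hab, rfl⟩ := hz
    have h : p - (a • p + b • q) = b • (p - q) := by
      rw [eq_sub_of_add_eq hab, sub_smul, one_smul, smul_sub]; abel
    rw [h, norm_smul, Real.norm_of_nonneg hb, norm_sub_rev p q]
    exact mul_le_of_le_one_left (norm_nonneg _) (by linarith)
  rw [InnerProductSpace.toDual_apply_apply] at hfz
  have h1 : inner ℝ (G p) (q - p) = f q - f p + inner ℝ (G p - G z) (q - p) := by
    rw [inner_sub_left, hfz]; ring
  have h2 : ‖G p - G z‖ ≤ L * ‖q - p‖ :=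
    (hLip.norm_sub_le hp hzP).trans (mul_le_mul_of_nonneg_left hzp L.2)
  have h3 := real_inner_le_norm (G p - G z) (q - p)
  have h4 := mul_le_mul_of_nonneg_right h2 (norm_nonneg (q - p))
  rw [h1]; nlinarith

/-- The first-order condition at a proximal point. -/
theorem IsProx.inner_nonneg (hP : Convex ℝ P)
    (hG : ∀ x ∈ P, HasGradientWithinAt f (G x) P x) {c : ℝ} {x w : E} (hw : IsProx f P c x w)
    {q : E} (hq : q ∈ P) : 0 ≤ inner ℝ (G w + (2 * c) • (w - x)) (q - w) := by
  have h1 : HasFDerivWithinAt (fun q => f q + c * ‖q - x‖ ^ 2)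
      (InnerProductSpace.toDual ℝ E (G w) + c • (2 • (innerSL ℝ (w - x)))) P w := by
    have := (((hasFDerivAt_id (𝕜 := ℝ) w).sub_const x).norm_sq).const_mul c
    exact (hG w hw.1).hasFDerivWithinAt.add (by simpa using! this.hasFDerivWithinAt)
  have h2 : IsLocalMinOn (fun q => f q + c * ‖q - x‖ ^ 2) P w :=
    IsMinOn.localize fun q hq => hw.2 q hq
  have h3 := h2.hasFDerivWithinAt_nonneg h1
    (sub_mem_posTangentConeAt_of_segment_subset (hP.segment_subset hw.1 hq))
  simp only [add_apply, smul_apply,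
    InnerProductSpace.toDual_apply_apply, innerSL_apply_apply, smul_eq_mul, nsmul_eq_mul] at h3
  rw [inner_add_left, real_inner_smul_left]
  push_cast at h3
  linarith

/-- For a parameter above the weak-convexity constant, the proximal point depends on the base point
in a Lipschitz way. -/
theorem IsProx.norm_sub_le (hP : Convex ℝ P)
    (hG : ∀ x ∈ P, HasGradientWithinAt f (G x) P x) (hLip : LipschitzOnWith L G P)
    {x w x' w' : E} (hw : IsProx f P (L + 1) x w) (hw' : IsProx f P (L + 1) x' w') :
    ‖w - w'‖ ≤ 2 * ‖x - x'‖ := by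
  have h1 := hw.inner_nonneg hP hG hw'.1
  have h2 := hw'.inner_nonneg hP hG hw.1
  have h3 := abs_le.1 ((abs_real_inner_le_norm (G w - G w') (w - w')).trans
    (mul_le_mul_of_nonneg_right (hLip.norm_sub_le hw.1 hw'.1) (norm_nonneg _)))
  have h4 := real_inner_le_norm (x - x') (w - w')
  have hL : (0 : ℝ) ≤ L := L.2
  have e : inner ℝ (G w + (2 * (L + 1 : ℝ)) • (w - x)) (w' - w)
      + inner ℝ (G w' + (2 * (L + 1 : ℝ)) • (w' - x')) (w - w')
      = - inner ℝ (G w - G w') (w - w') - 2 * (L + 1 : ℝ) * ‖w - w'‖ ^ 2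
        + 2 * (L + 1 : ℝ) * inner ℝ (x - x') (w - w') := by
    rw [← real_inner_self_eq_norm_sq]
    simp only [inner_add_left, inner_sub_left, inner_sub_right, real_inner_smul_left]
    ring
  by_contra! hcon
  have hpos : 0 < ‖w - w'‖ := lt_of_le_of_lt (by positivity) hcon
  have h5 : (L + 2 : ℝ) * ‖w - w'‖ ^ 2 ≤ 2 * (L + 1) * ‖x - x'‖ * ‖w - w'‖ := by
    have := mul_le_mul_of_nonneg_left h4 (by positivity : 0 ≤ 2 * (L + 1 : ℝ))
    nlinarith [h3.1]
  have h6 : (L + 2 : ℝ) * ‖w - w'‖ ≤ 2 * (L + 1) * ‖x - x'‖ :=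
    le_of_mul_le_mul_right (by linarith) hpos
  have h7 := mul_le_mul_of_nonneg_left hcon.le (by positivity : 0 ≤ (L + 1 : ℝ))
  linarith

/-- A point that moves under the proximal map by `D` sees the direction to its proximal point as a
descent direction, with slope at most `-D²`. -/
theorem IsProx.inner_gradient_le_neg_sq (hP : Convex ℝ P)
    (hG : ∀ x ∈ P, HasGradientWithinAt f (G x) P x) (hLip : LipschitzOnWith L G P)
    {x w : E} (hx : x ∈ P) (hw : IsProx f P (L + 1) x w) :
    inner ℝ (G x) (w - x) ≤ - ‖w - x‖ ^ 2 := by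
  have h1 := inner_gradient_le hP hG hLip hx hw.1
  have h2 := hw.2 x hx
  rw [sub_self, norm_zero] at h2
  linarith

/-- Along the recursion the Moreau envelope decreases, up to the noise terms, by a multiple of
`αₜ ‖w(pₜ) - pₜ‖²`. -/
theorem summable_mul_prox_residual_sq (hPc : IsCompact P) (hP : Convex ℝ P)
    (hG : ∀ x ∈ P, HasGradientWithinAt f (G x) P x) (hLip : LipschitzOnWith L G P)
    {w : E → E} (hw : ∀ x, IsProx f P (L + 1) x (w x)) {α : ℕ → ℝ} (hα : ∀ t, 0 < α t)
    {p ξ : ℕ → E} (hp : ∀ t, p t ∈ P)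
    (hstep : ∀ t, ∀ q ∈ P, ‖p (t + 1) - q‖ ^ 2 ≤ ‖p t - α t • (G (p t) + ξ t) - q‖ ^ 2)
    (hsq : Summable fun t => α t ^ 2 * ‖G (p t) + ξ t‖ ^ 2)
    {c : ℝ} (hnoise : Tendsto (fun T => ∑ t ∈ Finset.range T, α t * inner ℝ (ξ t) (w (p t) - p t))
      atTop (𝓝 c)) :
    Summable fun t => α t * ‖w (p t) - p t‖ ^ 2 := by
  have hf : ContinuousOn f P := fun x hx => (hG x hx).hasFDerivWithinAt.continuousWithinAt
  obtain ⟨b, hb⟩ := hPc.bddBelow_image hf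
  obtain ⟨C, hC⟩ := hnoise.bddAbove_range
  have hL : (0 : ℝ) ≤ L := L.2
  set K : ℝ := L + 1 with hK
  have hK0 : 0 < K := by positivity
  set V : ℕ → ℝ := fun t => f (w (p t)) + K * ‖w (p t) - p t‖ ^ 2 with hV
  have hVb : ∀ t, b ≤ V t := fun t => by
    have h1 := hb (Set.mem_image_of_mem f (hw (p t)).1)
    have : 0 ≤ K * ‖w (p t) - p t‖ ^ 2 := by positivity
    simp only [hV]; linarith
  have hdesc : ∀ t, 2 * K * (α t * ‖w (p t) - p t‖ ^ 2) ≤ V t - V (t + 1)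
      + 2 * K * (α t * inner ℝ (ξ t) (w (p t) - p t))
      + K * (α t ^ 2 * ‖G (p t) + ξ t‖ ^ 2) := by
    intro t
    have h1 := (hw (p (t + 1))).2 _ (hw (p t)).1
    have h2 := hstep t _ (hw (p t)).1
    have h3 := (hw (p t)).inner_gradient_le_neg_sq hP hG hLip (hp t)
    have e1 : p t - α t • (G (p t) + ξ t) - w (p t)
        = - (w (p t) - p t) - α t • (G (p t) + ξ t) := by abel
    rw [e1, norm_sub_sq_real (-(w (p t) - p t)), norm_neg, inner_neg_left, real_inner_smul_right, norm_smul,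
      mul_pow, Real.norm_eq_abs, sq_abs, inner_add_right, real_inner_comm (G (p t)),
      real_inner_comm (ξ t), norm_sub_rev] at h2
    have h4 := mul_le_mul_of_nonneg_left h2 hK0.le
    have h5 := mul_le_mul_of_nonneg_left h3 (mul_nonneg hK0.le (hα t).le)
    simp only [hV]
    linarith
  have hsum : ∀ T, 2 * K * ∑ t ∈ Finset.range T, α t * ‖w (p t) - p t‖ ^ 2
      ≤ V 0 - b + 2 * K * C + K * ∑' t, α t ^ 2 * ‖G (p t) + ξ t‖ ^ 2 := by
    intro T
    rw [Finset.mul_sum]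
    refine (Finset.sum_le_sum fun t _ => hdesc t).trans ?_
    rw [Finset.sum_add_distrib, Finset.sum_add_distrib, Finset.sum_range_sub', ← Finset.mul_sum,
      ← Finset.mul_sum]
    have h1 := hC (Set.mem_range_self T)
    have h2 := hsq.sum_le_tsum (Finset.range T) fun t _ => by positivity
    have h3 := mul_le_mul_of_nonneg_left h1 (by positivity : 0 ≤ 2 * K)
    have h4 := mul_le_mul_of_nonneg_left h2 hK0.le
    linarith [hVb T]
  refine summable_of_sum_range_le (c := (V 0 - b + 2 * K * C
    + K * ∑' t, α t ^ 2 * ‖G (p t) + ξ t‖ ^ 2) / (2 * K))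
    (fun t => mul_nonneg (hα t).le (sq_nonneg _)) fun T => ?_
  rw [le_div_iff₀ (by positivity)]
  linarith [hsum T]

end Deterministic

/-! ### Stationary points and cluster points -/

section Stationarity

variable {n : ℕ} {P : Set (Vec n)} {f : Vec n → ℝ} {G : Vec n → Vec n}

/-- Fixed points of the proximal map are stationary. -/
theorem mem_stationarySet_of_isProx (hP : Convex ℝ P)
    (hG : ∀ x ∈ P, HasGradientWithinAt f (G x) P x) {c : ℝ} {x : Vec n} (hx : IsProx f P c x x) :
    x ∈ stationarySet P G := by
  refine ⟨hx.1, -G x, fun q hq => ?_, add_neg_cancel _⟩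
  have := hx.inner_nonneg hP hG hq
  rw [sub_self, smul_zero, add_zero] at this
  rw [inner_neg_left]
  linarith

theorem stationarySet_nonempty (hPc : IsCompact P) (hP : Convex ℝ P) (hne : P.Nonempty)
    (hG : ∀ x ∈ P, HasGradientWithinAt f (G x) P x) : (stationarySet P G).Nonempty := by
  -- with parameter `0` a proximal point is a minimizer, whatever the base point
  obtain ⟨x, hx, hmin⟩ := exists_isProx hPc hne
    (fun x hx => (hG x hx).hasFDerivWithinAt.continuousWithinAt) 0 (0 : Vec n)
  exact ⟨x, mem_stationarySet_of_isProx hP hG (c := 0) ⟨hx, by simpa using hmin⟩⟩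

theorem mem_stationarySet_of_mapClusterPt (hP : Convex ℝ P)
    (hG : ∀ x ∈ P, HasGradientWithinAt f (G x) P x) {c : ℝ} {w : Vec n → Vec n}
    (hw : ∀ x, IsProx f P c x (w x)) (hwc : Continuous w) {p : ℕ → Vec n}
    (hlim : Tendsto (fun t => ‖w (p t) - p t‖) atTop (𝓝 0)) {x : Vec n}
    (hx : MapClusterPt x atTop p) : x ∈ stationarySet P G := by
  have hcont : Continuous fun x => ‖w x - x‖ := by fun_prop
  have h1 : MapClusterPt ‖w x - x‖ atTop fun t => ‖w (p t) - p t‖ :=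
    hx.continuousAt_comp (f := fun x => ‖w x - x‖) hcont.continuousAt
  have h2 : ‖w x - x‖ = 0 := by
    have : NeBot (𝓝 ‖w x - x‖ ⊓ 𝓝 0) := ClusterPt.mono h1 hlim
    exact eq_of_nhds_neBot this
  have h3 : w x = x := sub_eq_zero.1 (norm_eq_zero.1 h2)
  have h4 := hw x
  rw [h3] at h4
  exact mem_stationarySet_of_isProx hP hG h4

theorem tendsto_infDist_of_mapClusterPt {X : Type*} [PseudoMetricSpace X] {P S : Set X}
    (hP : IsCompact P) {p : ℕ → X} (hp : ∀ t, p t ∈ P)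
    (hS : ∀ x, MapClusterPt x atTop p → x ∈ S) :
    Tendsto (fun t => Metric.infDist (p t) S) atTop (𝓝 0) := by
  rw [Metric.tendsto_nhds]
  intro ε hε
  by_contra hcon
  have hK : IsCompact (P ∩ {x | ε ≤ Metric.infDist x S}) :=
    hP.inter_right (isClosed_le continuous_const (Metric.continuous_infDist_pt S))
  obtain ⟨a, ha, hac⟩ := hK.exists_mapClusterPt_of_frequently (f := p) (l := atTop) <|
    (not_eventually.1 hcon).mono fun t ht => ⟨hp t, by
      rwa [Real.dist_eq, sub_zero, abs_of_nonneg Metric.infDist_nonneg, not_lt] at ht⟩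
  have h1 : ε ≤ Metric.infDist a S := ha.2
  rw [Metric.infDist_zero_of_mem (hS a hac)] at h1
  exact hε.not_ge h1

end Stationarity

/-! ### Adaptedness of the iterates -/

section Measurability

variable {n : ℕ} {P : Set (Vec n)}

theorem exists_continuous_isMetricProj_eq (hPc : IsCompact P) (hP : Convex ℝ P)
    (hne : P.Nonempty) : ∃ π : Vec n → Vec n, Continuous π ∧ ∀ x y, IsMetricProj P x y → y = π x := by
  have hex : ∀ x, ∃ y, IsMetricProj P x y := fun x =>
    hPc.exists_isMinOn hne (f := fun q => ‖x - q‖) (by fun_prop)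
  choose π hπ using hex
  have hle : ∀ x y x' y', IsMetricProj P x y → IsMetricProj P x' y' → ‖y - y'‖ ≤ ‖x - x'‖ :=
    fun x y x' y' h h' => norm_sub_le_of_inner_sub_le_zero
      (inner_sub_le_zero_of_forall_norm_sub_le hP h.1 h.2 h'.1)
      (inner_sub_le_zero_of_forall_norm_sub_le hP h'.1 h'.2 h.1)
  refine ⟨π, (LipschitzWith.of_dist_le_mul (K := 1) fun x x' => ?_).continuous, fun x y hy => ?_⟩
  · simpa [dist_eq_norm] using hle _ _ _ _ (hπ x) (hπ x')
  · have := hle _ _ _ _ hy (hπ x)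
    rw [sub_self, norm_zero] at this
    exact sub_eq_zero.1 (norm_le_zero_iff.1 this)

/-- The iterates are adapted: on `P`, each is a continuous function of the previous one and of the
noise. -/
theorem stronglyMeasurable_of_isMetricProj_step (hPc : IsCompact P) (hP : Convex ℝ P)
    {G : Vec n → Vec n} {L : NNReal} (hLip : LipschitzOnWith L G P) {Ω : Type*}
    [mΩ : MeasurableSpace Ω] {ℱ : Filtration ℕ mΩ} {α : ℕ → ℝ} {p ξ : ℕ → Ω → Vec n}
    (hp : ∀ t ω, p t ω ∈ P)
    (hstep : ∀ t ω, IsMetricProj P (p t ω - α t • (G (p t ω) + ξ t ω)) (p (t + 1) ω))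
    (hp₀ : StronglyMeasurable[ℱ 0] (p 0)) (hξ : ∀ t, StronglyMeasurable[ℱ (t + 1)] (ξ t)) (t : ℕ) :
    StronglyMeasurable[ℱ t] (p t) := by
  rcases isEmpty_or_nonempty Ω with hΩ | ⟨⟨ω₀⟩⟩
  · exact @StronglyMeasurable.of_discrete _ _ (ℱ t) _ _ _ _
  obtain ⟨π, hπc, hπ⟩ := exists_continuous_isMetricProj_eq hPc hP ⟨_, hp 0 ω₀⟩
  obtain ⟨G', hG'c, hG'⟩ := hLip.extend_finite_dimension
  induction t with
  | zero => exact hp₀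
  | succ t ih =>
    have h1 := ih.mono (ℱ.mono t.le_succ)
    have h2 : p (t + 1) = fun ω => π (p t ω - α t • (G' (p t ω) + ξ t ω)) := by
      funext ω
      rw [← hG' (hp t ω)]
      exact hπ _ _ (hstep t ω)
    rw [h2]
    exact hπc.comp_stronglyMeasurable
      (h1.sub (((hG'c.continuous.comp_stronglyMeasurable h1).add (hξ t)).const_smul (α t)))

end Measurability

end SmoothOFO

/-! ### Convergence of the projected stochastic gradient recursion -/

open SmoothOFO

theorem theorem1 {n M : ℕ} (m : SmoothOFO.Model n M) (κ : SmoothOFO.KalmanParams n)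
    -- the price set
    (P : Set (SmoothOFO.Vec n)) (hPcompact : IsCompact P) (hPconvex : Convex ℝ P)
    -- Robbins–Monro step sizes
    (α : ℕ → ℝ) (hαpos : ∀ t, 0 < α t) (hαsum : ¬ Summable α)
    (hαsq : Summable fun t => α t ^ 2)
    -- the reduced objective is continuously differentiable on `P`, with Lipschitz gradient `G`
    (G : SmoothOFO.Vec n → SmoothOFO.Vec n)
    (hG : ∀ x ∈ P, HasGradientWithinAt m.reducedObj (G x) P x)
    (L : NNReal) (hLip : LipschitzOnWith L G P)
    -- the run of the algorithm
    {Ω : Type*} [mΩ : MeasurableSpace Ω] (μ : Measure Ω) [IsProbabilityMeasure μ]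
    (ℱ : Filtration ℕ mΩ) (p y v e : ℕ → Ω → SmoothOFO.Vec n)
    (hrun : SmoothOFO.IsRun m κ P α p y v e)
    (hp₀ : StronglyMeasurable[ℱ 0] (p 0))
    -- the gradient noise is adapted and has bounded variance
    (hξmeas : ∀ t, StronglyMeasurable[ℱ (t + 1)] (SmoothOFO.gradNoise m κ G p y e t))
    (hξL2 : ∀ t, MemLp (SmoothOFO.gradNoise m κ G p y e t) 2 μ)
    (σ : ℝ) (hξvar : ∀ t, ∫ ω, ‖SmoothOFO.gradNoise m κ G p y e t ω‖ ^ 2 ∂μ ≤ σ ^ 2)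
    -- its conditional mean is at most `β t`: for `β = 0` it is a martingale difference sequence
    (β : ℕ → ℝ) (hβ : Summable fun t => α t * β t)
    (hξbias : ∀ t, ∀ᵐ ω ∂μ, ‖(μ[SmoothOFO.gradNoise m κ G p y e t | ℱ t]) ω‖ ≤ β t) :
    (SmoothOFO.stationarySet P G).Nonempty ∧
    ∀ᵐ ω ∂μ,
      Tendsto (fun t => Metric.infDist (p t ω) (SmoothOFO.stationarySet P G)) atTop (𝓝 0) ∧
      ∀ pstar : SmoothOFO.Vec n, MapClusterPt pstar atTop (fun t => p t ω) →
        pstar ∈ SmoothOFO.stationarySet P G := by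
  set ξ := gradNoise m κ G p y e with hξ
  have hp : ∀ t ω, p t ω ∈ P := fun t ω => by
    cases t with
    | zero => exact hrun.init ω
    | succ t => exact (hrun.step t ω).1
  have hproj : ∀ t ω, IsMetricProj P (p t ω - α t • (G (p t ω) + ξ t ω)) (p (t + 1) ω) := by
    intro t ω
    have h := hrun.step t ω
    have hest : gradEstimate m κ (fun s => p s ω) (fun s => y s ω) (fun s => e s ω) t
        = G (p t ω) + ξ t ω := (add_sub_cancel _ _).symm
    rwa [hest] at h
  have hstep : ∀ t ω, ∀ q ∈ P,
      ‖p (t + 1) ω - q‖ ^ 2 ≤ ‖p t ω - α t • (G (p t ω) + ξ t ω) - q‖ ^ 2 := fun t ω q hq =>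
    norm_sub_sq_le_of_forall_norm_sub_le hPconvex (hproj t ω).1 (hproj t ω).2 hq
  obtain ⟨ω₀⟩ : Nonempty Ω := nonempty_of_isProbabilityMeasure μ
  have hne : P.Nonempty := ⟨_, hp 0 ω₀⟩
  have hmeas := stronglyMeasurable_of_isMetricProj_step hPcompact hPconvex hLip hp hproj hp₀ hξmeas
  obtain ⟨R, hR⟩ := hPcompact.isBounded.exists_norm_le
  obtain ⟨C, hC⟩ := (hPcompact.image_of_continuousOn hLip.continuousOn).isBounded.exists_norm_le
  have hGC : ∀ t ω, ‖G (p t ω)‖ ≤ C := fun t ω => hC _ (Set.mem_image_of_mem G (hp t ω))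
  choose w hw using exists_isProx hPcompact hne
    (fun x hx => (hG x hx).hasFDerivWithinAt.continuousWithinAt) (L + 1 : ℝ)
  have hwLip : ∀ x x', ‖w x - w x'‖ ≤ 2 * ‖x - x'‖ := fun x x' =>
    (hw x).norm_sub_le hPconvex hG hLip (hw x')
  have hwc : Continuous w := (LipschitzWith.of_dist_le_mul (K := 2) fun x x' => by
    simpa [dist_eq_norm] using hwLip x x').continuous
  refine ⟨stationarySet_nonempty hPcompact hPconvex hne hG, ?_⟩
  filter_upwards [ae_exists_tendsto_sum_smul hαpos hαsq hξmeas hξL2 hξvar hβ hξbias,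
    ae_exists_tendsto_sum_inner hαpos hαsq hξmeas hξL2 hξvar hβ hξbias hmeas
      (fun t ω => hR _ (hp t ω)),
    ae_exists_tendsto_sum_inner hαpos hαsq hξmeas hξL2 hξvar hβ hξbias
      (h := fun t ω => w (p t ω)) (fun t => hwc.comp_stronglyMeasurable (hmeas t))
      (fun t ω => hR _ (hw (p t ω)).1),
    ae_summable_of_summable_integral (μ := μ) (F := fun t ω => α t ^ 2 * ‖ξ t ω‖ ^ 2)
      (fun t ω => by positivity) (fun t => (hξL2 t).norm.integrable_sq.const_mul _)
      (hαsq.mul_right (σ ^ 2)) (fun t => by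
        rw [integral_const_mul]
        exact mul_le_mul_of_nonneg_left (hξvar t) (sq_nonneg _))]
    with ω ⟨a, ha⟩ ⟨b, hb⟩ ⟨c, hc⟩ hsq
  have hsq' : Summable fun t => α t ^ 2 * ‖G (p t ω) + ξ t ω‖ ^ 2 := by
    refine Summable.of_nonneg_of_le (fun t => by positivity) (fun t => ?_)
      ((hαsq.mul_right (2 * C ^ 2)).add (hsq.mul_left 2))
    have h1 : ‖G (p t ω) + ξ t ω‖ ^ 2 ≤ (C + ‖ξ t ω‖) ^ 2 :=
      pow_le_pow_left₀ (norm_nonneg _) ((norm_add_le _ _).trans (by gcongr; exact hGC t ω)) 2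
    have h2 : ‖G (p t ω) + ξ t ω‖ ^ 2 ≤ 2 * C ^ 2 + 2 * ‖ξ t ω‖ ^ 2 := by
      nlinarith [sq_nonneg (C - ‖ξ t ω‖)]
    have h3 := mul_le_mul_of_nonneg_left h2 (sq_nonneg (α t))
    linarith
  have hα0 : Tendsto α atTop (𝓝 0) := by
    have := hαsq.tendsto_atTop_zero.sqrt
    simpa [Real.sqrt_sq (hαpos _).le] using this
  have hres := summable_mul_prox_residual_sq hPcompact hPconvex hG hLip hw hαpos
    (p := fun t => p t ω) (ξ := fun t => ξ t ω) (fun t => hp t ω) (fun t => hstep t ω) hsq'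
    ((hc.sub hb).congr fun T => by simp [inner_sub_right, mul_sub, Finset.sum_sub_distrib])
  have hlim : Tendsto (fun t => ‖w (p t ω) - p t ω‖) atTop (𝓝 0) := by
    refine tendsto_zero_of_summable_mul_sq hαpos hα0 hαsum (fun t => norm_nonneg _) hres
      fun ε hε => ?_
    obtain ⟨N, η, hη, hN⟩ := exists_forall_norm_sub_le_of_sum_le hαpos (fun t => hp t ω)
      (fun t => hGC t ω) (fun t => hR _ (hp t ω)) (fun t => hstep t ω) hsq' ha hb
      (by positivity : 0 < ε / 3)
    refine ⟨N, η, hη, fun s hs t ht hst => ?_⟩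
    -- the residual `x ↦ ‖w x - x‖` is Lipschitz with constant `3`
    have h1 := hN s hs t ht hst
    have h2 := hwLip (p t ω) (p s ω)
    have h3 : ‖w (p t ω) - p t ω‖
        ≤ ‖w (p s ω) - p s ω‖ + ‖w (p t ω) - w (p s ω)‖ + ‖p t ω - p s ω‖ := by
      have e1 : w (p t ω) - p t ω
          = (w (p s ω) - p s ω) + (w (p t ω) - w (p s ω)) - (p t ω - p s ω) := by abel
      rw [e1]
      exact (norm_sub_le _ _).trans (add_le_add_left (norm_add_le _ _) _)
    linarith
  have hclus : ∀ x, MapClusterPt x atTop (fun t => p t ω) → x ∈ stationarySet P G := fun x hx =>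
    mem_stationarySet_of_mapClusterPt hPconvex hG hw hwc hlim hx
  exact ⟨tendsto_infDist_of_mapClusterPt hPcompact (fun t => hp t ω) hclus, hclus⟩
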